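/- Let $\mathbb{F}_q$ be a finite field with $q$ even, and let $n,k$ be integers with $3 \le k \le \frac q2 - 2$ and $$n > \begin{cases} \frac q2 + 1, & \text{if } k \in \{3, \frac q2 - 2\},\\ \frac q2, & \text{otherwise.}\end{cases}$$ Let $\alpha_1,\dots,\alpha_n \in \mathbb{F}_q$ be distinct and let $\eta \in \mathbb{F}_q$ with $\eta \neq 0$. Then the twisted Reed--Solomon code with one twist, twist $t=1$ and hook $h=k-1$, $$\mathcal{C} = \Big\{ \big(f(\alpha_1),\dots,f(\alpha_n)\big) : f = \sum_{i=0}^{k-1} f_i X^i + \eta f_{k-1} X^{k},\ f_0,\dots,f_{k-1} \in \mathbb{F}_q \Big\} \subseteq \mathbb{F}_q^n,$$ is not MDS, that is, its minimum Hamming distance $d$ does not satisfy $d = n - \dim_{\mathbb{F}_q} \mathcal{C} + 1$. -/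

import Mathlib

open Polynomial

noncomputable section

/-- The space of `[k, t, h, η]`-twisted polynomials with `ℓ` twists: all polynomials
`∑_{i < k} f_i X^i + ∑_{j} η_j f_{h_j} X^(k - 1 + t_j)` with coefficients `f_i` in `F`. -/
def twistedPolynomials {F : Type*} [Field F] (k : ℕ) {ℓ : ℕ}
    (t : Fin ℓ → ℕ) (h : Fin ℓ → Fin k) (η : Fin ℓ → F) : Submodule F F[X] where
  carrier := {p | ∃ f : Fin k → F,
    p = ∑ i : Fin k, C (f i) * X ^ (i : ℕ) + ∑ j : Fin ℓ, C (η j * f (h j)) * X ^ (k - 1 + t j)}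
  zero_mem' := ⟨0, by simp⟩
  add_mem' := by
    rintro _ _ ⟨f, rfl⟩ ⟨g, rfl⟩
    refine ⟨f + g, ?_⟩
    simp only [Pi.add_apply, mul_add, C_add, add_mul, Finset.sum_add_distrib]
    ring
  smul_mem' := by
    rintro c _ ⟨f, rfl⟩
    refine ⟨c • f, ?_⟩
    simp only [Pi.smul_apply, smul_eq_mul, smul_add, Finset.smul_sum, smul_eq_C_mul, C_mul]
    congr 1 <;> exact Finset.sum_congr rfl fun _ _ => by ring

/-- The evaluation map `f ↦ (f(α_1), …, f(α_n))`, as a linear map. -/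
def evaluationMap {F : Type*} [Field F] {n : ℕ} (α : Fin n → F) : F[X] →ₗ[F] (Fin n → F) :=
  LinearMap.pi fun i => Polynomial.leval (α i)

/-- The `[α, t, h, η]`-twisted Reed--Solomon code: the evaluation at `α_1, …, α_n` of the
`[k, t, h, η]`-twisted polynomials. It is used for distinct `α_i`, `k < n`, `1 ≤ t_j ≤ n - k`
and distinct pairs `(h_j, t_j)`. -/
def twistedRSCode {F : Type*} [Field F] {n : ℕ} (k : ℕ) {ℓ : ℕ} (α : Fin n → F)
    (t : Fin ℓ → ℕ) (h : Fin ℓ → Fin k) (η : Fin ℓ → F) : Submodule F (Fin n → F) :=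
  (twistedPolynomials k t h η).map (evaluationMap α)

/-- The minimum Hamming distance between distinct codewords of a linear code
(with value `0` for the zero code). -/
def minimumDistance {F : Type*} [Field F] [DecidableEq F] {n : ℕ}
    (C : Submodule F (Fin n → F)) : ℕ :=
  sInf {d | ∃ x ∈ C, ∃ y ∈ C, x ≠ y ∧ hammingDist x y = d}

/-- A linear code of length `n` is MDS (maximum distance separable) if it attains the Singleton
bound: its minimum distance `d` and dimension satisfy `d + dim = n + 1`. -/
def IsMDS {F : Type*} [Field F] [DecidableEq F] {n : ℕ} (C : Submodule F (Fin n → F)) : Prop :=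
  minimumDistance C + Module.finrank F C = n + 1

end

/-!
A codeword with at least `k` zeros has weight at most `n - k`, too small for an MDS code of
dimension at most `k`. The monic polynomial with roots `α i`, `i ∈ s`, where `#s = k`, is a twisted
polynomial as soon as the sum of these roots is `-η⁻¹`. So it suffices that every element of an
elementary abelian `2`-group `G` is a sum of `k` distinct elements of a set `A` with slightly more
than `|G| / 2` elements.

Averaging over `c ≠ 0` gives a `c` for which more than half of `A` consists of pairs `{x, x + c}`.
Adding `j` such pairs to a sum of `t` elements of `A` changes it by `j • c` and turns `t` into
`t + 2 * j`, so for `k ≤ |A| / 2` one can start from sums of two or three elements: every `b ≠ 0`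
is a sum of two, and all `b` but at most one are sums of three. Larger `k` follow by passing to
complements in `A`.
-/

section SubsetSums

open Finset

variable {G : Type*} [AddCommGroup G] {A B : Finset G} {b b' c d e x z : G} {j k l m t : ℕ}

/-- `b` is a sum of `k` distinct elements of `A`. -/
def IsSubsetSum (A : Finset G) (k : ℕ) (b : G) : Prop :=
  ∃ S ⊆ A, #S = k ∧ ∑ x ∈ S, x = b

theorem IsSubsetSum.mono (h : IsSubsetSum A k b) (hAB : A ⊆ B) : IsSubsetSum B k b :=
  let ⟨S, hSA, hS⟩ := h
  ⟨S, hSA.trans hAB, hS⟩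

theorem isSubsetSum_singleton (x : G) : IsSubsetSum {x} 1 x :=
  ⟨{x}, Subset.rfl, card_singleton x, sum_singleton id x⟩

theorem IsSubsetSum.union [DecidableEq G] (hA : IsSubsetSum A k b) (hB : IsSubsetSum B l b')
    (hAB : Disjoint A B) : IsSubsetSum (A ∪ B) (k + l) (b + b') := by
  obtain ⟨S, hSA, rfl, rfl⟩ := hA
  obtain ⟨T, hTB, rfl, rfl⟩ := hB
  have hST : Disjoint S T := disjoint_of_subset_left hSA (disjoint_of_subset_right hTB hAB)
  exact ⟨S ∪ T, union_subset_union hSA hTB, card_union_of_disjoint hST, sum_union hST⟩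

theorem IsSubsetSum.compl (h : IsSubsetSum A k b) :
    IsSubsetSum A (#A - k) (∑ x ∈ A, x - b) := by
  classical
  obtain ⟨S, hSA, rfl, rfl⟩ := h
  exact ⟨A \ S, sdiff_subset, card_sdiff_of_subset hSA, sum_sdiff_eq_sub hSA⟩

section CharTwo

variable [Module (ZMod 2) G]

theorem add_add_cancel_right_of_zmod_two (x c : G) : x + c + c = x := by
  rw [add_assoc, ZModModule.add_self, add_zero]

theorem nsmul_eq_zero_of_even (hj : Even j) (c : G) : j • c = 0 := by
  obtain ⟨i, rfl⟩ := hj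
  rw [add_nsmul, ZModModule.add_self]

theorem nsmul_eq_self_of_odd (hj : Odd j) (c : G) : j • c = c := by
  obtain ⟨i, rfl⟩ := hj
  rw [succ_nsmul, nsmul_eq_zero_of_even (even_two_mul i), zero_add]

theorem even_card_of_forall_add_mem {P : Finset G} (hc : c ≠ 0) (hP : ∀ x ∈ P, x + c ∈ P) :
    Even #P := by
  have hsum : ∑ _x ∈ P, (1 : ZMod 2) = 0 :=
    sum_involution (fun x _ => x + c) (fun _ _ => by decide) (fun x _ _ => by simpa using hc)
      hP (fun x _ => add_add_cancel_right_of_zmod_two x c)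
  rw [sum_const, nsmul_eq_mul, mul_one] at hsum
  exact (ZMod.natCast_eq_zero_iff_even).1 hsum

theorem two_pow_succ_dvd_card [Fintype G] (hk : 2 ^ k < Fintype.card G) :
    2 ^ (k + 1) ∣ Fintype.card G := by
  rw [Module.card_eq_pow_finrank (K := ZMod 2), ZMod.card] at hk ⊢
  exact pow_dvd_pow 2 ((Nat.pow_lt_pow_iff_right one_lt_two).1 hk)

theorem isSubsetSum_pair [DecidableEq G] (hd : d ≠ 0) (x : G) :
    IsSubsetSum {x, x + d} 2 d := by
  have hne : x ≠ x + d := by simpa using hd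
  refine ⟨_, Subset.rfl, card_pair hne, ?_⟩
  rw [sum_pair hne, ← add_assoc, ZModModule.add_self, zero_add]

theorem isSubsetSum_two_mul_of_forall_add_mem (hc : c ≠ 0) {P : Finset G}
    (hP : ∀ x ∈ P, x + c ∈ P) (hj : 2 * j ≤ #P) : IsSubsetSum P (2 * j) (j • c) := by
  classical
  induction j generalizing P with
  | zero => exact ⟨∅, by simp⟩
  | succ j ih =>
    obtain ⟨x, hx⟩ : P.Nonempty := card_pos.1 (by omega)
    have hpair : {x, x + c} ⊆ P := insert_subset hx (singleton_subset_iff.2 (hP x hx))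
    have hrest : IsSubsetSum (P \ {x, x + c}) (2 * j) (j • c) := by
      refine ih (fun y hy => ?_) ?_
      · simp only [mem_sdiff, mem_insert, mem_singleton, not_or] at hy ⊢
        refine ⟨hP y hy.1, fun h => hy.2.2 ?_, fun h => hy.2.1 (add_right_cancel h)⟩
        rw [← h, add_add_cancel_right_of_zmod_two]
      · have := card_sdiff_of_subset hpair
        have := card_le_two (a := x) (b := x + c)
        omega
    rw [succ_nsmul, mul_add_one]
    exact (hrest.union (isSubsetSum_pair hc x) sdiff_disjoint).mono
      (union_subset sdiff_subset hpair)

end CharTwo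

section PairedElements

variable [DecidableEq G]

/-- The elements of `A` whose translate by `c` lies in `A` as well. In characteristic two they
form the pairs `{x, x + c} ⊆ A`, each of which has sum `c`. -/
def pairedElements (A : Finset G) (c : G) : Finset G := {x ∈ A | x + c ∈ A}

theorem mem_pairedElements : x ∈ pairedElements A c ↔ x ∈ A ∧ x + c ∈ A := by
  simp [pairedElements]

theorem pairedElements_subset (A : Finset G) (c : G) : pairedElements A c ⊆ A :=
  filter_subset _ _

theorem two_mul_card_le_card_pairedElements_add [Fintype G] (A : Finset G) (c : G) :
    2 * #A ≤ #(pairedElements A c) + Fintype.card G := by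
  have hunpaired : #{x ∈ A | x + c ∉ A} ≤ #Aᶜ :=
    card_le_card_of_injOn (· + c) (fun x hx => by simpa using (mem_filter.1 hx).2)
      (add_left_injective c).injOn
  have hsplit : #(pairedElements A c) + #{x ∈ A | x + c ∉ A} = #A :=
    card_filter_add_card_filter_not _
  have := card_add_card_compl A
  omega

theorem sum_card_pairedElements [Fintype G] (A : Finset G) :
    ∑ c, #(pairedElements A c) = #A * #A := by
  have hfiber (x : G) : #{c | x + c ∈ A} = #A :=
    card_equiv (Equiv.addLeft x) (by simp)
  calc ∑ c, #(pairedElements A c)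
      = ∑ x ∈ A, #{c | x + c ∈ A} := by
        simp only [pairedElements, card_filter]
        exact sum_comm
    _ = #A * #A := by simp only [hfiber, sum_const, smul_eq_mul]

variable [Module (ZMod 2) G]

theorem add_mem_pairedElements (hx : x ∈ pairedElements A c) : x + c ∈ pairedElements A c := by
  rw [mem_pairedElements] at hx ⊢
  exact ⟨hx.2, by rw [add_add_cancel_right_of_zmod_two]; exact hx.1⟩

theorem even_card_pairedElements (A : Finset G) (hc : c ≠ 0) : Even #(pairedElements A c) :=
  even_card_of_forall_add_mem hc fun _ => add_mem_pairedElements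

theorem card_pairedElements_lt_card (hA : Odd #A) (hc : c ≠ 0) : #(pairedElements A c) < #A :=
  (card_le_card (pairedElements_subset A c)).lt_of_ne fun h =>
    Nat.not_even_iff_odd.2 hA (h ▸ even_card_pairedElements A hc)

theorem isSubsetSum_two_of_mem_pairedElements (hd : d ≠ 0) (hx : x ∈ pairedElements A d) :
    IsSubsetSum A 2 d := by
  rw [mem_pairedElements] at hx
  exact (isSubsetSum_pair hd x).mono (insert_subset hx.1 (singleton_subset_iff.2 hx.2))

theorem isSubsetSum_three_of_two_lt_card_pairedElements (hz : z ∈ A) (hbz : b ≠ z)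
    (h : 2 < #(pairedElements A (b - z))) : IsSubsetSum A 3 b := by
  obtain ⟨x, hx, hxzb⟩ : ∃ x ∈ pairedElements A (b - z), x ∉ ({z, b} : Finset G) :=
    exists_mem_notMem_of_card_lt_card (card_le_two.trans_lt h)
  simp only [mem_insert, mem_singleton, not_or] at hxzb
  rw [mem_pairedElements] at hx
  have hxd : x + (b - z) ≠ z := by
    rw [ZModModule.sub_eq_add, ← add_assoc, Ne, add_eq_right, ← ZModModule.sub_eq_add, sub_eq_zero]
    exact hxzb.2
  have hpair : IsSubsetSum (A.erase z) 2 (b - z) :=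
    isSubsetSum_two_of_mem_pairedElements (sub_ne_zero.2 hbz) <| mem_pairedElements.2
      ⟨mem_erase.2 ⟨hxzb.1, hx.1⟩, mem_erase.2 ⟨hxd, hx.2⟩⟩
  have htriple := hpair.union (isSubsetSum_singleton z) (by simp)
  rw [sub_add_cancel] at htriple
  exact htriple.mono (union_subset (erase_subset z A) (singleton_subset_iff.2 hz))

theorem IsSubsetSum.add_two_mul (hc : c ≠ 0) (h : IsSubsetSum A t (b + j • c))
    (hj : 2 * (t + j) ≤ #(pairedElements A c)) : IsSubsetSum A (t + 2 * j) b := by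
  obtain ⟨T, hTA, hTcard, hTsum⟩ := h
  set T' := T ∪ T.image (· + c) with hT'
  have hT'card : #T' ≤ t + t :=
    (card_union_le _ _).trans (add_le_add hTcard.le (card_image_le.trans hTcard.le))
  have hstable : ∀ x ∈ pairedElements A c \ T', x + c ∈ pairedElements A c \ T' := by
    intro x hx
    simp only [hT', mem_sdiff, mem_union, mem_image, not_or, not_exists, not_and] at hx ⊢
    refine ⟨add_mem_pairedElements hx.1,
      fun h => hx.2.2 _ h (add_add_cancel_right_of_zmod_two x c), fun y hy h => hx.2.1 ?_⟩
    rwa [← add_right_cancel h]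
  have hpairs : IsSubsetSum (pairedElements A c \ T') (2 * j) (j • c) := by
    refine isSubsetSum_two_mul_of_forall_add_mem hc hstable ?_
    have := le_card_sdiff T' (pairedElements A c)
    omega
  have hdisj : Disjoint T (pairedElements A c \ T') :=
    disjoint_of_subset_left subset_union_left disjoint_sdiff
  have hunion := IsSubsetSum.union ⟨T, Subset.rfl, hTcard, hTsum⟩ hpairs hdisj
  rw [add_add_cancel_right_of_zmod_two] at hunion
  exact hunion.mono (union_subset hTA (sdiff_subset.trans (pairedElements_subset A c)))

variable [Fintype G]

theorem exists_add_two_le_card_pairedElements (hG : Fintype.card G = 4 * m) (hm : Even m)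
    (hA : #A = 2 * m + 1) (e : G) : ∃ c ≠ 0, c ≠ e ∧ m + 2 ≤ #(pairedElements A c) := by
  have hG_pos : 0 < Fintype.card G := Fintype.card_pos
  by_contra! hfew
  have hle (c : G) : #(pairedElements A c) ≤
      m + (if c = 0 then m + 1 else 0) + if c = e then m else 0 := by
    rcases eq_or_ne c 0 with rfl | hc
    · have := card_le_card (pairedElements_subset A 0)
      rw [if_pos rfl]
      omega
    · have hlt := card_pairedElements_lt_card (hA ▸ odd_two_mul_add_one m) hc
      rw [if_neg hc]
      split_ifs with hce
      · omega
      · have hlt_two := hfew c hc hce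
        have := even_card_pairedElements A hc
        grind
  have hsum := sum_le_sum fun c (_ : c ∈ univ) => hle c
  rw [sum_card_pairedElements] at hsum
  simp only [sum_add_distrib, sum_const, card_univ, sum_ite_eq', mem_univ, if_true, smul_eq_mul,
    hG, hA] at hsum
  nlinarith

/-- A nonzero `d` pairs at most `2 * m` elements of `A`, and at most two if `b + d ∈ A`. The total
`(2 * m + 1) ^ 2` of the numbers of paired elements forces equality at all the other `d`. -/
theorem two_mul_le_card_pairedElements_of_not_isSubsetSum_three (hG : Fintype.card G = 4 * m)
    (hA : #A = 2 * m + 1) (hb : ¬ IsSubsetSum A 3 b) (hc : c ≠ 0) (hbc : b + c ∉ A) :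
    2 * m ≤ #(pairedElements A c) := by
  have hG_pos : 0 < Fintype.card G := Fintype.card_pos
  obtain ⟨i, rfl⟩ : ∃ i, m = i + 1 := ⟨m - 1, by omega⟩
  by_contra! hlt
  have hle (d : G) : #(pairedElements A d) + (if b + d ∈ A then 2 * i else 0) ≤
      2 * (i + 1) + if d = 0 then 2 * i + 1 else 0 := by
    rcases eq_or_ne d 0 with rfl | hd
    · have := card_le_card (pairedElements_subset A 0)
      rw [if_pos rfl]
      split_ifs <;> omega
    · have hd_lt := card_pairedElements_lt_card (hA ▸ odd_two_mul_add_one (i + 1)) hd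
      rw [if_neg hd]
      split_ifs with hbd
      · have hd_two : #(pairedElements A d) ≤ 2 := by
          by_contra! h
          refine hb (isSubsetSum_three_of_two_lt_card_pairedElements hbd (by simpa using hd) ?_)
          rwa [sub_add_cancel_left, ZModModule.neg_eq_self]
        omega
      · omega
  have hsum := sum_lt_sum (fun d (_ : d ∈ univ) => hle d) ⟨c, mem_univ c, by simpa [hc, hbc]⟩
  have htranslate : ∑ d, (if b + d ∈ A then 2 * i else 0) = #A * (2 * i) := by
    rw [← sum_filter, sum_const, smul_eq_mul, card_equiv (t := A) (Equiv.addLeft b) (by simp)]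
  rw [sum_add_distrib, sum_card_pairedElements, htranslate] at hsum
  simp only [sum_add_distrib, sum_const, card_univ, sum_ite_eq', mem_univ, if_true, smul_eq_mul,
    hG, hA] at hsum
  nlinarith

end PairedElements

variable [Module (ZMod 2) G] [Fintype G]

theorem isSubsetSum_two_of_half_lt_card (hA : Fintype.card G < 2 * #A) (hb : b ≠ 0) :
    IsSubsetSum A 2 b := by
  classical
  have := two_mul_card_le_card_pairedElements_add A b
  obtain ⟨x, hx⟩ : (pairedElements A b).Nonempty := card_pos.1 (by omega)
  exact isSubsetSum_two_of_mem_pairedElements hb hx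

theorem isSubsetSum_three_of_half_add_two_le_card (hA : Fintype.card G + 4 ≤ 2 * #A) (b : G) :
    IsSubsetSum A 3 b := by
  classical
  have hG : 0 < Fintype.card G := Fintype.card_pos
  obtain ⟨z, hz, hzb⟩ := exists_mem_ne (show 1 < #A by omega) b
  refine isSubsetSum_three_of_two_lt_card_pairedElements hz hzb.symm ?_
  have := two_mul_card_le_card_pairedElements_add A (b - z)
  omega

theorem exists_forall_ne_isSubsetSum_three (hG : Fintype.card G = 4 * m) (hm : 2 ≤ m)
    (hA : #A = 2 * m + 1) : ∃ e, ∀ b ≠ e, IsSubsetSum A 3 b := by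
  classical
  have eq_of_not_isSubsetSum {b b' x : G} (hb : ¬ IsSubsetSum A 3 b)
      (hb' : ¬ IsSubsetSum A 3 b') (hxA : x ∈ A) (hx : x + (b + b') ∉ A) : x = b := by
    by_contra! hxb
    refine hb (isSubsetSum_three_of_two_lt_card_pairedElements hxA hxb.symm ?_)
    have := two_mul_le_card_pairedElements_of_not_isSubsetSum_three hG hA hb'
      (sub_ne_zero.2 hxb.symm)
      (by rwa [ZModModule.sub_eq_add, ← add_assoc, add_comm, add_comm b'])
    omega
  by_contra! hex
  obtain ⟨b, -, hb⟩ := hex 0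
  obtain ⟨b', hbb', hb'⟩ := hex b
  obtain ⟨x, hxA, hx⟩ : ∃ x ∈ A, x + (b + b') ∉ A := by
    by_contra! hstable
    have hne : b + b' ≠ 0 := by rwa [← ZModModule.sub_eq_add, sub_ne_zero, ne_comm]
    have heven := even_card_of_forall_add_mem hne hstable
    rw [hA] at heven
    exact Nat.not_even_two_mul_add_one m heven
  have hxb : x = b := eq_of_not_isSubsetSum hb hb' hxA hx
  have hxb' : x = b' := eq_of_not_isSubsetSum hb' hb hxA (by rwa [add_comm b'])
  exact hbb' (hxb'.symm.trans hxb)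

theorem IsSubsetSum.add_two_mul_of_even (h : IsSubsetSum A t b) (hG : Fintype.card G = 4 * m)
    (hm : Even m) (hA : #A = 2 * m + 1) (hj : Even j) (htj : 2 * (t + j) ≤ m + 2) :
    IsSubsetSum A (t + 2 * j) b := by
  classical
  obtain ⟨c, hc, -, hcard⟩ := exists_add_two_le_card_pairedElements hG hm hA 0
  exact IsSubsetSum.add_two_mul hc (by rwa [nsmul_eq_zero_of_even hj, add_zero])
    (htj.trans hcard)

theorem isSubsetSum_add_two_mul_of_odd (h : ∀ b ≠ e, IsSubsetSum A t b)
    (hG : Fintype.card G = 4 * m) (hm : Even m) (hA : #A = 2 * m + 1) (hj : Odd j)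
    (htj : 2 * (t + j) ≤ m + 2) (b : G) : IsSubsetSum A (t + 2 * j) b := by
  classical
  obtain ⟨c, hc, hce, hcard⟩ := exists_add_two_le_card_pairedElements hG hm hA (e - b)
  refine IsSubsetSum.add_two_mul hc (h _ ?_) (htj.trans hcard)
  rwa [nsmul_eq_self_of_odd hj, Ne, ← eq_sub_iff_add_eq']

theorem isSubsetSum_of_even (hG : Fintype.card G = 4 * m) (hm : 4 ∣ m) (hA : #A = 2 * m + 1)
    (hk : 4 ≤ k) (hkm : k ≤ m) (hk_even : Even k) (b : G) : IsSubsetSum A k b := by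
  have hm_even : Even m := even_iff_two_dvd.2 (dvd_trans (by norm_num) hm)
  have htwo : ∀ b ≠ 0, IsSubsetSum A 2 b := fun b hb =>
    isSubsetSum_two_of_half_lt_card (by omega) hb
  have hfour : ∀ b, IsSubsetSum A 4 b :=
    isSubsetSum_add_two_mul_of_odd htwo hG hm_even hA odd_one (by omega)
  obtain ⟨i, rfl | rfl⟩ : ∃ i, k = 2 + 2 * (2 * i + 1) ∨ k = 4 + 2 * (2 * i + 1) :=
    ⟨(k - 4) / 4, by grind⟩
  · exact isSubsetSum_add_two_mul_of_odd htwo hG hm_even hA (odd_two_mul_add_one i) (by omega) b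
  · exact isSubsetSum_add_two_mul_of_odd (e := 0) (fun b _ => hfour b) hG hm_even hA
      (odd_two_mul_add_one i) (by omega) b

theorem isSubsetSum_of_odd (hG : Fintype.card G = 4 * m) (hm : 4 ∣ m) (hA : #A = 2 * m + 1)
    (hk : 4 ≤ k) (hkm : k ≤ m) (hk_odd : Odd k) (b : G) : IsSubsetSum A k b := by
  classical
  have hm_even : Even m := even_iff_two_dvd.2 (dvd_trans (by norm_num) hm)
  obtain ⟨e, hthree⟩ := exists_forall_ne_isSubsetSum_three hG (by omega) hA
  obtain ⟨i, rfl | rfl⟩ : ∃ i, k = 3 + 2 * (2 * i + 1) ∨ k = 3 + 2 * (2 * (i + 1)) :=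
    ⟨(k - 5) / 4, by grind⟩
  · exact isSubsetSum_add_two_mul_of_odd hthree hG hm_even hA (odd_two_mul_add_one i) (by omega) b
  by_cases hb : IsSubsetSum A 3 b
  · exact hb.add_two_mul_of_even hG hm_even hA (even_two_mul (i + 1)) (by omega)
  -- An exceptional `b` yields a `c` pairing almost all of `A`, which leaves room for five summands.
  have hfive : ∀ b, IsSubsetSum A 5 b :=
    isSubsetSum_add_two_mul_of_odd hthree hG hm_even hA odd_one (by omega)
  obtain ⟨c, -, hc⟩ : ∃ c ∈ univ, c ∉ insert 0 (A.image (· - b)) := by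
    refine exists_mem_notMem_of_card_lt_card ?_
    have := card_insert_le 0 (A.image (· - b))
    have := card_image_le (s := A) (f := (· - b))
    rw [card_univ]
    omega
  simp only [mem_insert, mem_image, not_or, not_exists, not_and] at hc
  have hcard := two_mul_le_card_pairedElements_of_not_isSubsetSum_three hG hA hb hc.1
    fun hbc => hc.2 _ hbc (add_sub_cancel_left b c)
  have := IsSubsetSum.add_two_mul (j := 2 * i + 1) hc.1 (hfive (b + (2 * i + 1) • c)) (by omega)
  convert this using 1
  ring

theorem isSubsetSum_of_card_eq (hG : Fintype.card G = 4 * m) (hm : 4 ∣ m) (hA : #A = 2 * m + 1)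
    (hk : 4 ≤ k) (hkm : k + 3 ≤ 2 * m) (b : G) : IsSubsetSum A k b := by
  have hsmall {k : ℕ} (hk : 4 ≤ k) (hkm : k ≤ m) (b : G) : IsSubsetSum A k b :=
    (Nat.even_or_odd k).elim (isSubsetSum_of_even hG hm hA hk hkm · b)
      (isSubsetSum_of_odd hG hm hA hk hkm · b)
  rcases le_or_gt k m with hkm' | hkm'
  · exact hsmall hk hkm' b
  · have hcompl := (hsmall (k := #A - k) (by omega) (by omega) (∑ x ∈ A, x - b)).compl
    rwa [sub_sub_cancel, Nat.sub_sub_self (by omega)] at hcompl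

theorem isSubsetSum_of_half_lt_card {N : ℕ} (hG : Fintype.card G = 2 * N) (hk : 3 ≤ k)
    (hkN : k + 2 ≤ N) (hA : if k = 3 ∨ k + 2 = N then N + 1 < #A else N < #A) (b : G) :
    IsSubsetSum A k b := by
  obtain ⟨m, rfl, hm⟩ : ∃ m, N = 2 * m ∧ 4 ∣ m := by
    have : 2 ^ 4 ∣ Fintype.card G := two_pow_succ_dvd_card (by omega)
    exact ⟨N / 2, by omega, by omega⟩
  have hG' : Fintype.card G = 4 * m := by omega
  split_ifs at hA with hextreme
  · rcases hextreme with rfl | hk_max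
    · exact isSubsetSum_three_of_half_add_two_le_card (by omega) b
    · obtain ⟨B, hBA, hB⟩ := exists_subset_card_eq (show 2 * m + 2 ≤ #A by omega)
      obtain ⟨B', hB'B, hB'⟩ := exists_subset_card_eq (show 2 * m + 1 ≤ #B by omega)
      have hfour := isSubsetSum_of_card_eq hG' hm hB' le_rfl (by omega) (∑ x ∈ B, x - b)
      have hcompl := (hfour.mono hB'B).compl
      rw [sub_sub_cancel, show #B - 4 = k by omega] at hcompl
      exact hcompl.mono hBA
  · obtain ⟨B, hBA, hB⟩ := exists_subset_card_eq (show 2 * m + 1 ≤ #A by omega)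
    exact (isSubsetSum_of_card_eq hG' hm hB (by omega) (by omega) b).mono hBA

end SubsetSums

section LinearCodes

variable {F : Type*} [Field F] {n k ℓ : ℕ}

theorem minimumDistance_le_hammingNorm [DecidableEq F] {C : Submodule F (Fin n → F)}
    {x : Fin n → F} (hxC : x ∈ C) (hx : x ≠ 0) : minimumDistance C ≤ hammingNorm x :=
  Nat.sInf_le ⟨x, hxC, 0, C.zero_mem, hx, hammingDist_zero_right x⟩

/-- The parametrization of the twisted polynomials by their `k` free coefficients. -/
noncomputable def twistedPolynomialMap (k : ℕ) (t : Fin ℓ → ℕ) (h : Fin ℓ → Fin k)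
    (η : Fin ℓ → F) : (Fin k → F) →ₗ[F] F[X] :=
  ∑ i : Fin k, monomial (i : ℕ) ∘ₗ LinearMap.proj i +
    ∑ j : Fin ℓ, η j • (monomial (k - 1 + t j) ∘ₗ LinearMap.proj (h j))

theorem range_twistedPolynomialMap (t : Fin ℓ → ℕ) (h : Fin ℓ → Fin k) (η : Fin ℓ → F) :
    LinearMap.range (twistedPolynomialMap k t h η) = twistedPolynomials k t h η := by
  ext p
  change (∃ f, twistedPolynomialMap k t h η f = p) ↔ ∃ f : Fin k → F, p = _
  simp only [twistedPolynomialMap, LinearMap.add_apply, LinearMap.sum_apply, LinearMap.comp_apply,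
    LinearMap.smul_apply, LinearMap.proj_apply, smul_monomial, smul_eq_mul, C_mul_X_pow_eq_monomial,
    eq_comm]

theorem finrank_twistedRSCode_le (α : Fin n → F) (t : Fin ℓ → ℕ) (h : Fin ℓ → Fin k)
    (η : Fin ℓ → F) : Module.finrank F (twistedRSCode k α t h η) ≤ k := by
  rw [twistedRSCode, ← range_twistedPolynomialMap, ← LinearMap.range_comp]
  exact (LinearMap.finrank_range_le _).trans_eq (Module.finrank_fin_fun F)

theorem hammingNorm_evaluationMap_prod_X_sub_C [DecidableEq F] {α : Fin n → F}
    (hα : Function.Injective α) (s : Finset (Fin n)) :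
    hammingNorm (evaluationMap α (∏ i ∈ s, (X - C (α i)))) = sᶜ.card := by
  rw [hammingNorm]
  congr 1
  ext i
  simp [evaluationMap, leval, eval_prod, Finset.prod_eq_zero_iff, sub_eq_zero, hα.eq_iff]

theorem prod_X_sub_C_mem_twistedPolynomials {ι : Type*} (hk : k - 1 < k) {η : F} {s : Finset ι}
    {a : ι → F} (hs : s.card = k) (hsum : η * ∑ i ∈ s, a i = -1) :
    ∏ i ∈ s, (X - C (a i)) ∈ twistedPolynomials k ![1] ![⟨k - 1, hk⟩] ![η] := by
  set p : F[X] := ∏ i ∈ s, (X - C (a i)) with hp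
  have hmonic : p.Monic := monic_prod_X_sub_C a s
  have hdeg : p.natDegree = k := by rw [hp, natDegree_finsetProd_X_sub_C_eq_card, hs]
  have hcoeff : η * p.coeff (k - 1) = 1 := by
    rw [hp, ← hs, prod_X_sub_C_coeff_card_pred s a (by omega), mul_neg, hsum, neg_neg]
  refine ⟨fun i => p.coeff i, ?_⟩
  conv_lhs => rw [hmonic.as_sum, hdeg, Finset.sum_range, add_comm]
  simp [hcoeff, show k - 1 + 1 = k by omega]

theorem not_isMDS_of_mul_sum_eq_neg_one [DecidableEq F] {α : Fin n → F}
    (hα : Function.Injective α) (hk : k - 1 < k) (hkn : k < n) {η : F} {s : Finset (Fin n)}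
    (hs : s.card = k) (hsum : η * ∑ i ∈ s, α i = -1) :
    ¬ IsMDS (twistedRSCode k α ![1] ![⟨k - 1, hk⟩] ![η]) := by
  have hmem : evaluationMap α (∏ i ∈ s, (X - C (α i))) ∈
      twistedRSCode k α ![1] ![⟨k - 1, hk⟩] ![η] :=
    Submodule.mem_map_of_mem (prod_X_sub_C_mem_twistedPolynomials hk hs hsum)
  have hweight := hammingNorm_evaluationMap_prod_X_sub_C hα s
  rw [Finset.card_compl, Fintype.card_fin, hs] at hweight
  have hdist := minimumDistance_le_hammingNorm hmem (hammingNorm_pos_iff.1 (by omega))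
  have hdim := finrank_twistedRSCode_le α ![1] ![⟨k - 1, hk⟩] ![η]
  rw [IsMDS]
  omega

end LinearCodes
theorem mainTheorem10 {F : Type*} [Field F] [Fintype F] [DecidableEq F]
    (hq : Even (Fintype.card F)) (n k : ℕ) (hk : 3 ≤ k) (hkq : k + 2 ≤ Fintype.card F / 2)
    (hn : if k = 3 ∨ k + 2 = Fintype.card F / 2
      then Fintype.card F / 2 + 1 < n else Fintype.card F / 2 < n)
    (α : Fin n → F) (hα : Function.Injective α) (η : F) (hη : η ≠ 0) :
    ¬ IsMDS (twistedRSCode k α ![1] ![⟨k - 1, Nat.sub_one_lt_of_lt hk⟩] ![η]) := by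
  have : CharP F 2 := ringChar.eq_iff.1 (FiniteField.even_card_iff_char_two.2 (Nat.even_iff.1 hq))
  let _ : Algebra (ZMod 2) F := ZMod.algebra F 2
  have hcard : (Finset.univ.map ⟨α, hα⟩).card = n := by simp
  obtain ⟨S, hSα, hS, hsum⟩ : IsSubsetSum (Finset.univ.map ⟨α, hα⟩) k (-η⁻¹) :=
    isSubsetSum_of_half_lt_card (Nat.two_mul_div_two_of_even hq).symm hk hkq (by rwa [hcard]) _
  obtain ⟨s, -, rfl⟩ := Finset.subset_map_iff.1 hSα
  rw [Finset.card_map] at hS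
  rw [Finset.sum_map, Function.Embedding.coeFn_mk] at hsum
  refine not_isMDS_of_mul_sum_eq_neg_one hα _ (by split_ifs at hn <;> omega) hS ?_
  rw [hsum, mul_neg, mul_inv_cancel₀ hη]
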